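/- **Timed automata.** A timed automaton $\mathcal A$ has a finite set $L$ of locations, clocks $x_1,\dots,x_n$ and a set of edges $(\ell_1,\varphi,\lambda,\ell_2)$ with $\lambda\subseteq\{x_1,\dots,x_n\}$, where guards are given by $\varphi::=\mathrm{true}\mid x<k\mid x=k\mid x>k\mid\varphi\wedge\varphi$ with $k\in\mathbb N$. Configurations are pairs $\langle\ell,\nu\rangle$ with $\ell\in L$ and $\nu\in\mathbb R_{\ge0}^n$. Its transitions are delays $\langle\ell,\nu\rangle\to\langle\ell,\nu+d\rangle$ ($d\ge0$) and, for each edge with $\nu\models\varphi$, $\langle\ell_1,\nu\rangle\to\langle\ell_2,\nu[\lambda\leftarrow0]\rangle$; reachability is the reflexive transitive closure. Assume that every edge resets at most one clock and that $x_n$ is never reset. $\lfloor\nu\rfloor$ and $\mathrm{frac}(\nu)$ denote the componentwise integer and fractional parts, and $\nu_0=0$. **DBMs.** Let $D$ be a linearly ordered set with an addition and integer constants. A DBM over $D$ is a matrix $(M_{i,j})_{0\le i,j\le n}$ with entries in $(\{<,\le\}\times D)\cup\{(<,\infty)\}$. Entries are ordered by: $(\prec,m)\le(\prec',m')$ iff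 $m<m'$, or $m=m'$ and ($\prec$ is $<$ or $\prec'$ is $\le$). They are added componentwise, where the symbol of a sum is $\le$ iff both symbols are $\le$, and $m+\infty=\infty$. Define $\overrightarrow M_{i,j}=(<,\infty)$ if $i\ne0$, $j=0$, and $\overrightarrow M_{i,j}=M_{i,j}$ otherwise; $M[x_l\leftarrow0]_{i,j}=M_{i_l,j_l}$, where $l_l=0$ and $k_l=k$ for $k\ne l$; and $(M\cap(x_p-x_q\prec c))_{i,j}=\min\big(M_{i,j},\,M_{i,p}+(\prec,c)+M_{q,j}\big)$ for $c\in\mathbb Z$. Here $x_0$ stands for $0$, and intersection with a conjunction of constraints is done successively. The set $\mathrm{closure}(M)$ is the least set that contains $M$ and, with each $N$, the DBMs $N\cap(x_p-x_q\prec c)$ for all $0\le p,q\le n$, ${\prec}\in\{<,\le\}$, $c\in\mathbb Z$; $\overrightarrow N\cap\bigcap_{i=1}^n(x_i\le1)$; $N[x_i\leftarrow0]$ for $0\le i\le n-1$; and $(N\cap(x_n=1))[x_n\leftarrow0]$. For $D=\mathbb R$ the zone of $M=(\prec_{i,j},m_{i,j})$ is $[\![M]\!]=\{\nu\in\mathbb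 R_{\ge0}^n:\nu_i-\nu_j\prec_{i,j}m_{i,j}\text{ for all }0\le i,j\le n\}$. **Types.** The type of $\nu\in[0,1]^n$ is the set of all formulas $t\le t'$ true under $r_i\mapsto\nu_i$, where $t,t'$ range over the terms built from rational constants and the variables $r_0,\dots,r_n$ by $+$ and $-$. An $n$-type $\tau$ is the type of some such valuation. Let $\mathcal T(\tau)$ be the set of terms modulo the equivalence "$t\le t'$ and $t'\le t$ lie in $\tau$", with the order $[t]\le[t']$ iff $(t\le t')\in\tau$ and the addition $[t]+[t']=[t+t']$. A parametric DBM is a DBM over $\mathcal T(\tau)$. If $\nu$ has type $\tau$, then $\nu(\mathcal M)$ is the real DBM obtained by evaluating the entries of $\mathcal M$ under $\nu$. $\mathcal M$ is consistent if $[\![\nu(\mathcal M)]\!]\neq\emptyset$ for some valuation $\nu$ of type $\tau$ (equivalently, for every one). $\mathcal M_\tau$ is the parametric DBM with entries $(\le,[r_i-r_j])$. **The machine $\mathcal C_{\langle\ell,\tau\rangle}$.** It is a monotonic counter machine with counters $c_1,\dots,c_n$ over $\mathbb N$: each edge carries a guard on the counters and one operation, which is $\mathit{nop}$, $\mathit{inc}(c_i)$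 or $\mathit{reset}(c_i)$. Its configurations are pairs of a state and a counter valuation, an edge can be taken when its guard holds, and reachability is the reflexive transitive closure of the resulting steps. The states are the pairs $\langle\ell_1,\mathcal M\rangle$ with $\ell_1\in L$ and $\mathcal M\in\mathrm{closure}(\mathcal M_\tau)$ consistent. Its edges are those of the following forms whose two ends are states: - from $\langle\ell_1,\mathcal M\rangle$ to $\langle\ell_1,\overrightarrow{\mathcal M}\cap\bigcap_{i=1}^n(x_i\le1)\rangle$, with guard true and operation $\mathit{nop}$; - from $\langle\ell_1,\mathcal M\rangle$ to $\langle\ell_1,(\mathcal M\cap(x_i=1))[x_i\leftarrow0]\rangle$, with guard true and operation $\mathit{inc}(c_i)$, for each clock $x_i$; - for each edge $(\ell_1,\varphi,\lambda,\ell_2)$ of $\mathcal A$ and each disjunct $\psi$ of $\varphi$: from $\langle\ell_1,\mathcal M\rangle$ with guard $\psi_{\mathsf{int}}$, to $\langle\ell_2,(\mathcal M\cap\psi_{\mathsf{frac}})[x_i\leftarrow0]\rangle$ with operation $\mathit{reset}(c_i)$ if $\lambda=\{x_i\}$, and to $\langle\ell_2,\mathcal M\cap\psi_{\mathsf{frac}}\rangle$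 with operation $\mathit{nop}$ if $\lambda=\emptyset$. Here $\varphi$ is written as a disjunction of conjunctions of basic guards $x<k$, $x=k$, $k<x<k+1$, $x\ge k$, with $x>k$ replaced by $(k<x<k+1)\vee(x\ge k+1)$. The integer parts of the basic guards are, in this order, $c\le k-1$, $c=k$, $c=k$, $c\ge k$, and their fractional parts are $x<1$, $x=0$, $0<x<1$, $x\ge0$; for a conjunction $\psi$, both parts are taken conjunct by conjunct. **Theorem.** Let $\mathcal A$ be as above, let $\langle\ell,\nu\rangle$ and $\langle\ell',\nu'\rangle$ be configurations of $\mathcal A$, and let $\tau$ be the type of $\mathrm{frac}(\nu)$. Then $\langle\ell',\nu'\rangle$ is reachable from $\langle\ell,\nu\rangle$ in $\mathcal A$ if and only if there is a parametric DBM $\mathcal M'\in\mathrm{closure}(\mathcal M_\tau)$ such that $\langle\langle\ell',\mathcal M'\rangle,\lfloor\nu'\rfloor\rangle$ is reachable from $\langle\langle\ell,\mathcal M_\tau\rangle,\lfloor\nu\rfloor\rangle$ in $\mathcal C_{\langle\ell,\tau\rangle}$ and $\mathrm{frac}(\nu')\in[\![\mathrm{frac}(\nu)(\mathcal M')]\!]$.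 -/

import Mathlib

open scoped NNReal

namespace TimedReach

/-! ## Timed automata -/

/-- Clock constraints over the clocks `x₁, …, xₙ`; the clock `xᵢ₊₁` is represented by `i : Fin n`. -/
inductive ClockConstraint (n : ℕ) : Type
  | tt : ClockConstraint n
  | lt (x : Fin n) (k : ℕ) : ClockConstraint n
  | eq (x : Fin n) (k : ℕ) : ClockConstraint n
  | gt (x : Fin n) (k : ℕ) : ClockConstraint n
  | and (φ ψ : ClockConstraint n) : ClockConstraint n

/-- Clock valuations. -/
abbrev Valuation (n : ℕ) : Type := Fin n → ℝ≥0

namespace Valuation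

/-- `ν + t`. -/
def delay {n : ℕ} (ν : Valuation n) (t : ℝ≥0) : Valuation n := fun x => ν x + t

/-- `ν[R ← 0]`. -/
def reset {n : ℕ} (ν : Valuation n) (R : Finset (Fin n)) : Valuation n :=
  fun x => if x ∈ R then 0 else ν x

/-- Fractional parts of all clocks. -/
noncomputable def frac {n : ℕ} (ν : Valuation n) : Valuation n :=
  fun x => ⟨Int.fract (ν x : ℝ), Int.fract_nonneg _⟩

/-- Integer parts of all clocks. -/
noncomputable def floor {n : ℕ} (ν : Valuation n) : Fin n → ℕ := fun x => ⌊ν x⌋₊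

/-- The family `ν₀, ν₁, …, νₙ` with the convention `ν₀ = 0`. -/
def ext {n : ℕ} (ν : Valuation n) : Fin (n + 1) → ℝ := Fin.cons 0 (fun x => (ν x : ℝ))

end Valuation

/-- Satisfaction of clock constraints. -/
def ClockConstraint.Sat {n : ℕ} (ν : Valuation n) : ClockConstraint n → Prop
  | .tt => True
  | .lt x k => ν x < k
  | .eq x k => ν x = k
  | .gt x k => (k : ℝ≥0) < ν x
  | .and φ ψ => φ.Sat ν ∧ ψ.Sat ν

/-- An edge `⟨source, guard, reset set, target⟩`. -/
structure Edge (L : Type*) (n : ℕ) where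
  src : L
  guard : ClockConstraint n
  resets : Finset (Fin n)
  tgt : L

/-- A timed automaton with locations `L` and clocks `x₁, …, xₙ`. -/
structure TimedAutomaton (L : Type*) (n : ℕ) where
  edges : Set (Edge L n)

namespace TimedAutomaton

/-- The labelled transition relation on configurations. -/
inductive Step {L : Type*} {n : ℕ} (A : TimedAutomaton L n) :
    L × Valuation n → ℝ≥0 → L × Valuation n → Prop
  | delay (ℓ : L) (ν : Valuation n) (d : ℝ≥0) : Step A (ℓ, ν) d (ℓ, ν.delay d)
  | discrete (e : Edge L n) (he : e ∈ A.edges) (ν : Valuation n) (hν : e.guard.Sat ν) :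
      Step A (e.src, ν) 0 (e.tgt, ν.reset e.resets)

/-- There is a finite run from the first configuration to the second. -/
def Reachable {L : Type*} {n : ℕ} (A : TimedAutomaton L n) :
    L × Valuation n → L × Valuation n → Prop :=
  Relation.ReflTransGen (fun q q' => ∃ d, A.Step q d q')

/-- The reference clock `xₙ` is never reset. -/
def NeverResetsLast {L : Type*} {n : ℕ} (A : TimedAutomaton L n) : Prop :=
  ∀ e ∈ A.edges, ∀ x ∈ e.resets, (x : ℕ) + 1 ≠ n

/-- Every edge resets at most one clock. -/
def ResetsAtMostOne {L : Type*} {n : ℕ} (A : TimedAutomaton L n) : Prop :=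
  ∀ e ∈ A.edges, e.resets.card ≤ 1

end TimedAutomaton

/-! ## Monotonic counter machines -/

/-- Guards over the counters `c₁, …, cₙ`. -/
inductive CounterGuard (n : ℕ) : Type
  | tt : CounterGuard n
  | lt (c : Fin n) (k : ℤ) : CounterGuard n
  | eq (c : Fin n) (k : ℤ) : CounterGuard n
  | gt (c : Fin n) (k : ℤ) : CounterGuard n
  | and (φ ψ : CounterGuard n) : CounterGuard n

/-- Satisfaction of counter guards. -/
def CounterGuard.Sat {n : ℕ} (υ : Fin n → ℕ) : CounterGuard n → Prop
  | .tt => True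
  | .lt c k => (υ c : ℤ) < k
  | .eq c k => (υ c : ℤ) = k
  | .gt c k => k < (υ c : ℤ)
  | .and φ ψ => φ.Sat υ ∧ ψ.Sat υ

/-- Counter operations. -/
inductive CounterOp (n : ℕ) : Type
  | reset (c : Fin n) : CounterOp n
  | inc (c : Fin n) : CounterOp n
  | nop : CounterOp n

/-- The effect of a counter operation. -/
def CounterOp.apply {n : ℕ} (υ : Fin n → ℕ) : CounterOp n → (Fin n → ℕ)
  | .reset c => Function.update υ c 0
  | .inc c => Function.update υ c (υ c + 1)
  | .nop => υ

/-- A monotonic counter machine with `n` counters, whose states are drawn from the type `S`. -/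
structure CounterMachine (S : Type*) (n : ℕ) where
  states : Set S
  edges : Set (S × CounterGuard n × CounterOp n × S)
  edges_states : ∀ s g o s', (s, g, o, s') ∈ edges → s ∈ states ∧ s' ∈ states

namespace CounterMachine

/-- The transition relation on configurations. -/
def Step {S : Type*} {n : ℕ} (C : CounterMachine S n) (p q : S × (Fin n → ℕ)) : Prop :=
  ∃ g o, (p.1, g, o, q.1) ∈ C.edges ∧ g.Sat p.2 ∧ q.2 = o.apply p.2

/-- Reachability: the reflexive transitive closure of the transition relation. -/
def Reachable {S : Type*} {n : ℕ} (C : CounterMachine S n) :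
    S × (Fin n → ℕ) → S × (Fin n → ℕ) → Prop :=
  Relation.ReflTransGen C.Step

end CounterMachine

/-! ## Difference bound matrices

The definitions are generic in the type `α` of numerical entries: concrete matrices have
`α = ℝ`, parametric ones have classes of terms as entries. -/

/-- The two inequality symbols. -/
inductive Ineq : Type
  | lt : Ineq
  | le : Ineq

/-- `a ≺ b` for real numbers. -/
def Ineq.Holds : Ineq → ℝ → ℝ → Prop
  | .lt, a, b => a < b
  | .le, a, b => a ≤ b

/-- The inequality symbol of a sum. -/
def Ineq.add : Ineq → Ineq → Ineq
  | .le, .le => .le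
  | _, _ => .lt

/-- Matrix entries: `fin ≺ m` is `(≺, m)`, and `top` is `(<, ∞)`. -/
inductive Bound (α : Type*) : Type _
  | fin (r : Ineq) (m : α) : Bound α
  | top : Bound α

namespace Bound

/-- The total order on entries. -/
def Le {α : Type*} [LinearOrder α] : Bound α → Bound α → Prop
  | _, .top => True
  | .top, .fin _ _ => False
  | .fin r m, .fin r' m' => m < m' ∨ (m = m' ∧ (r = .lt ∨ r' = .le))

/-- The sum of two entries. -/
def add {α : Type*} [Add α] : Bound α → Bound α → Bound α
  | .fin r m, .fin r' m' => .fin (r.add r') (m + m')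
  | _, _ => .top

open Classical in
/-- The minimum of two entries. -/
noncomputable def min {α : Type*} [LinearOrder α] (a b : Bound α) : Bound α :=
  if a.Le b then a else b

/-- Apply a function to the numerical part. -/
def map {α β : Type*} (f : α → β) : Bound α → Bound β
  | .fin r m => .fin r (f m)
  | .top => .top

/-- The real number `a` obeys the bound. -/
def Holds (a : ℝ) : Bound ℝ → Prop
  | .fin r m => r.Holds a m
  | .top => True

end Bound

/-- Difference bound matrices of dimension `n`; the entry `M i j` bounds `xᵢ - xⱼ`, and `x₀`
stands for zero. -/
def DBM (α : Type*) (n : ℕ) : Type _ := Fin (n + 1) → Fin (n + 1) → Bound α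

/-- An atomic difference constraint `x_p - x_q ≺ c` with an integer constant. -/
structure Atom (n : ℕ) where
  p : Fin (n + 1)
  q : Fin (n + 1)
  rel : Ineq
  c : ℤ

namespace DBM

/-- The zone of a concrete matrix. -/
def zone {n : ℕ} (M : DBM ℝ n) : Set (Valuation n) :=
  {ν | ∀ i j, (M i j).Holds (ν.ext i - ν.ext j)}

/-- Apply a function to all numerical entries. -/
def map {α β : Type*} {n : ℕ} (f : α → β) (M : DBM α n) : DBM β n := fun i j => (M i j).map f

/-- Time elapse. -/
def elapse {α : Type*} {n : ℕ} (M : DBM α n) : DBM α n :=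
  fun i j => if i ≠ 0 ∧ j = 0 then .top else M i j

/-- The reset `M[x_l ← 0]`. -/
def reset {α : Type*} {n : ℕ} (M : DBM α n) (l : Fin (n + 1)) : DBM α n :=
  fun i j => M (if i = l then 0 else i) (if j = l then 0 else j)

/-- Intersection with an atomic constraint (combined with canonisation). -/
noncomputable def meet {α : Type*} [LinearOrder α] [Add α] [IntCast α] {n : ℕ}
    (M : DBM α n) (a : Atom n) : DBM α n :=
  fun i j => (M i j).min (((M i a.p).add (.fin a.rel (a.c : α))).add (M a.q j))

/-- Successive intersection with finitely many atomic constraints. -/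
noncomputable def meetAll {α : Type*} [LinearOrder α] [Add α] [IntCast α] {n : ℕ}
    (M : DBM α n) (as : List (Atom n)) : DBM α n :=
  as.foldl meet M

/-- Time elapse inside the unit cube: time elapse intersected with `xᵢ ≤ 1` for `i = 1, …, n`. -/
noncomputable def unitElapse {α : Type*} [LinearOrder α] [Add α] [IntCast α] {n : ℕ}
    (M : DBM α n) : DBM α n :=
  M.elapse.meetAll (List.ofFn fun x : Fin n => ⟨x.succ, 0, .le, 1⟩)

/-- `(M ∩ (xᵢ = 1))[xᵢ ← 0]`. -/
noncomputable def wrap {α : Type*} [LinearOrder α] [Add α] [IntCast α] {n : ℕ}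
    (M : DBM α n) (i : Fin (n + 1)) : DBM α n :=
  (M.meetAll [⟨i, 0, .le, 1⟩, ⟨0, i, .le, -1⟩]).reset i

/-- `M.Closure N` states that `N ∈ closure(M)`. -/
inductive Closure {α : Type*} [LinearOrder α] [Add α] [IntCast α] {n : ℕ} (M : DBM α n) :
    DBM α n → Prop
  | base : Closure M M
  | meet (N : DBM α n) (a : Atom n) : Closure M N → Closure M (N.meet a)
  | elapse (N : DBM α n) : Closure M N → Closure M N.unitElapse
  | reset (N : DBM α n) (i : Fin (n + 1)) (hi : (i : ℕ) < n) :
      Closure M N → Closure M (N.reset i)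
  | wrap (N : DBM α n) : Closure M N → Closure M (N.wrap (Fin.last n))

/-- The set `closure(M)`. -/
def closure {α : Type*} [LinearOrder α] [Add α] [IntCast α] {n : ℕ} (M : DBM α n) :
    Set (DBM α n) :=
  {N | M.Closure N}

end DBM

/-! ## Types and parametric difference bound matrices -/

/-- Terms of real arithmetic in the variables `r₀, …, rₙ`. -/
inductive RTerm (n : ℕ) : Type
  | const (c : ℚ) : RTerm n
  | var (i : Fin (n + 1)) : RTerm n
  | add (t u : RTerm n) : RTerm n
  | sub (t u : RTerm n) : RTerm n

/-- The value of a term under a valuation, with `r₀` interpreted as zero. -/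
def RTerm.eval {n : ℕ} (ν : Valuation n) : RTerm n → ℝ
  | .const c => (c : ℝ)
  | .var i => ν.ext i
  | .add t u => t.eval ν + u.eval ν
  | .sub t u => t.eval ν - u.eval ν

/-- The type of a valuation; the pair `(t, u)` represents the atomic formula `t ≤ u`. -/
def typeOf {n : ℕ} (ν : Valuation n) : Set (RTerm n × RTerm n) :=
  {f | f.1.eval ν ≤ f.2.eval ν}

/-- `n`-types: the types of the valuations in the unit cube. -/
structure NType (n : ℕ) where
  carrier : Set (RTerm n × RTerm n)
  isType : ∃ ν : Valuation n, (∀ x, ν x ≤ 1) ∧ typeOf ν = carrier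

theorem NType.mem_iff {n : ℕ} {τ : NType n} {ν : Valuation n} (h : typeOf ν = τ.carrier)
    (t u : RTerm n) : (t, u) ∈ τ.carrier ↔ t.eval ν ≤ u.eval ν := by
  rw [← h]; rfl

/-- Equivalence of terms with respect to a type. -/
def NType.setoid {n : ℕ} (τ : NType n) : Setoid (RTerm n) where
  r t u := (t, u) ∈ τ.carrier ∧ (u, t) ∈ τ.carrier
  iseqv := by
    obtain ⟨ν, -, h⟩ := τ.isType
    simp only [τ.mem_iff h]
    exact ⟨fun _ => ⟨le_rfl, le_rfl⟩, fun h => ⟨h.2, h.1⟩,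
      fun h h' => ⟨h.1.trans h'.1, h'.2.trans h.2⟩⟩

/-- Equivalence classes of terms. -/
def TermClass {n : ℕ} (τ : NType n) : Type := Quotient τ.setoid

namespace TermClass

/-- The class `[t]`. -/
def mk {n : ℕ} (τ : NType n) (t : RTerm n) : TermClass τ := Quotient.mk τ.setoid t

/-- The order on classes: `[t] ≤ [u]` iff the formula `t ≤ u` lies in the type. -/
instance {n : ℕ} (τ : NType n) : LE (TermClass τ) where
  le := Quotient.lift₂ (fun t u => (t, u) ∈ τ.carrier) (by
    obtain ⟨ν, -, h⟩ := τ.isType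
    rintro t u t' u' ⟨h₁, h₂⟩ ⟨h₃, h₄⟩
    simp only [τ.mem_iff h] at *
    exact propext ⟨fun H => h₂.trans (H.trans h₃), fun H => h₁.trans (H.trans h₄)⟩)

theorem mk_le_mk {n : ℕ} {τ : NType n} {t u : RTerm n} :
    mk τ t ≤ mk τ u ↔ (t, u) ∈ τ.carrier := Iff.rfl

open Classical in
noncomputable instance {n : ℕ} (τ : NType n) : LinearOrder (TermClass τ) where
  le_refl a := by
    obtain ⟨ν, -, h⟩ := τ.isType
    induction a using Quotient.ind with | _ t =>
    exact (τ.mem_iff h t t).2 le_rfl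
  le_trans a b c := by
    obtain ⟨ν, -, h⟩ := τ.isType
    induction a using Quotient.ind with | _ t =>
    induction b using Quotient.ind with | _ u =>
    induction c using Quotient.ind with | _ v =>
    intro h₁ h₂
    exact (τ.mem_iff h t v).2 (((τ.mem_iff h t u).1 h₁).trans ((τ.mem_iff h u v).1 h₂))
  le_antisymm a b := by
    induction a using Quotient.ind with | _ t =>
    induction b using Quotient.ind with | _ u =>
    intro h₁ h₂
    exact Quotient.sound ⟨h₁, h₂⟩
  le_total a b := by
    obtain ⟨ν, -, h⟩ := τ.isType
    induction a using Quotient.ind with | _ t =>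
    induction b using Quotient.ind with | _ u =>
    exact (le_total (t.eval ν) (u.eval ν)).imp (τ.mem_iff h t u).2 (τ.mem_iff h u t).2
  toDecidableLE := Classical.decRel _

/-- Addition of classes: `[t] + [u] = [t + u]`. -/
instance {n : ℕ} (τ : NType n) : Add (TermClass τ) where
  add := Quotient.map₂ RTerm.add (by
    obtain ⟨ν, -, h⟩ := τ.isType
    rintro t t' ⟨h₁, h₂⟩ u u' ⟨h₃, h₄⟩
    rw [τ.mem_iff h] at h₁ h₂ h₃ h₄
    exact ⟨(τ.mem_iff h _ _).2 (add_le_add h₁ h₃), (τ.mem_iff h _ _).2 (add_le_add h₂ h₄)⟩)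

/-- The integer constants as classes. -/
instance {n : ℕ} (τ : NType n) : IntCast (TermClass τ) where
  intCast c := mk τ (.const (c : ℚ))

/-- A valuation of type `τ` acts on the classes by `[t] ↦ ν(t)`. -/
def eval {n : ℕ} {τ : NType n} (ν : Valuation n) (hν : typeOf ν = τ.carrier) :
    TermClass τ → ℝ :=
  Quotient.lift (RTerm.eval ν) (fun t u h =>
    le_antisymm ((τ.mem_iff hν t u).1 h.1) ((τ.mem_iff hν u t).1 h.2))

end TermClass

/-- Parametric difference bound matrices over the classes of terms of a type. -/
abbrev PDBM {n : ℕ} (τ : NType n) : Type := DBM (TermClass τ) n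

/-- The parametric matrix `M_τ` with entries `(≤, [rᵢ - rⱼ])`. -/
def NType.matrix {n : ℕ} (τ : NType n) : PDBM τ :=
  fun i j => .fin .le (TermClass.mk τ (.sub (.var i) (.var j)))

/-- The concrete matrix `ν(M)`. -/
def PDBM.inst {n : ℕ} {τ : NType n} (ν : Valuation n) (hν : typeOf ν = τ.carrier)
    (M : PDBM τ) : DBM ℝ n :=
  DBM.map (TermClass.eval ν hν) M

/-- A parametric matrix is consistent if its instances at the valuations of type `τ` have a
non-empty zone. Whether an instance does is determined by the type, so one instance suffices. -/
def PDBM.Consistent {n : ℕ} {τ : NType n} (M : PDBM τ) : Prop :=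
  ∃ (ν : Valuation n) (hν : typeOf ν = τ.carrier), (PDBM.inst ν hν M).zone.Nonempty

/-! ## Decomposition of guards -/

/-- Basic guards: `x < k`, `x = k`, `k < x < k + 1` and `x ≥ k`. -/
inductive BasicGuard (n : ℕ) : Type
  | lt (x : Fin n) (k : ℕ) : BasicGuard n
  | eq (x : Fin n) (k : ℕ) : BasicGuard n
  | between (x : Fin n) (k : ℕ) : BasicGuard n
  | ge (x : Fin n) (k : ℕ) : BasicGuard n

namespace BasicGuard

/-- The integer part: `c ≤ k - 1`, `c = k`, `c = k`, `c ≥ k`. -/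
def int {n : ℕ} : BasicGuard n → CounterGuard n
  | .lt x k => .lt x k
  | .eq x k => .eq x k
  | .between x k => .eq x k
  | .ge x k => .gt x ((k : ℤ) - 1)

/-- The fractional part: `x < 1`, `x = 0`, `0 < x < 1`, `x ≥ 0`. -/
def frac {n : ℕ} : BasicGuard n → List (Atom n)
  | .lt x _ => [⟨x.succ, 0, .lt, 1⟩]
  | .eq x _ => [⟨x.succ, 0, .le, 0⟩, ⟨0, x.succ, .le, 0⟩]
  | .between x _ => [⟨0, x.succ, .lt, 0⟩, ⟨x.succ, 0, .lt, 1⟩]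
  | .ge x _ => [⟨0, x.succ, .le, 0⟩]

/-- The integer part of a conjunction of basic guards. -/
def conjInt {n : ℕ} (bs : List (BasicGuard n)) : CounterGuard n :=
  bs.foldr (fun b g => .and b.int g) .tt

/-- The fractional part of a conjunction of basic guards. -/
def conjFrac {n : ℕ} (bs : List (BasicGuard n)) : List (Atom n) := bs.flatMap frac

end BasicGuard

/-- A clock constraint as a disjunction of conjunctions of basic guards, where `x > k` is
expressed as `k < x < k + 1` or `x ≥ k + 1`. -/
def ClockConstraint.dnf {n : ℕ} : ClockConstraint n → List (List (BasicGuard n))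
  | .tt => [[]]
  | .lt x k => [[.lt x k]]
  | .eq x k => [[.eq x k]]
  | .gt x k => [[.between x k], [.ge x (k + 1)]]
  | .and φ ψ => φ.dnf.flatMap (fun a => ψ.dnf.map (fun b => a ++ b))

/-! ## The parametric region automaton -/

/-- The labelled edges between pairs of a location and a matrix: delay edges, wrapping edges, and
the discrete edges coming from the edges of `A`, one for each disjunct of the guard. -/
inductive RegionEdge {L : Type*} {n : ℕ} {α : Type*} [LinearOrder α] [Add α] [IntCast α]
    (A : TimedAutomaton L n) :
    L × DBM α n → CounterGuard n → CounterOp n → L × DBM α n → Prop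
  | delay (ℓ : L) (M : DBM α n) : RegionEdge A (ℓ, M) .tt .nop (ℓ, M.unitElapse)
  | wrap (ℓ : L) (M : DBM α n) (x : Fin n) :
      RegionEdge A (ℓ, M) .tt (.inc x) (ℓ, M.wrap x.succ)
  | discreteReset (e : Edge L n) (he : e ∈ A.edges) (x : Fin n) (hx : e.resets = {x})
      (d : List (BasicGuard n)) (hd : d ∈ e.guard.dnf) (M : DBM α n) :
      RegionEdge A (e.src, M) (BasicGuard.conjInt d) (.reset x)
        (e.tgt, (M.meetAll (BasicGuard.conjFrac d)).reset x.succ)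
  | discreteNop (e : Edge L n) (he : e ∈ A.edges) (hx : e.resets = ∅)
      (d : List (BasicGuard n)) (hd : d ∈ e.guard.dnf) (M : DBM α n) :
      RegionEdge A (e.src, M) (BasicGuard.conjInt d) .nop
        (e.tgt, M.meetAll (BasicGuard.conjFrac d))

/-- The counter machine of `A` and the type `τ`: the states are the pairs of a location and a
consistent parametric matrix in the closure of `M_τ`. (It does not depend on the location from
which one starts.) -/
def regionMachine {L : Type*} {n : ℕ} (A : TimedAutomaton L n) (τ : NType n) :
    CounterMachine (L × PDBM τ) n where
  states := {s | s.2 ∈ τ.matrix.closure ∧ s.2.Consistent}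
  edges := {e | (e.1.2 ∈ τ.matrix.closure ∧ e.1.2.Consistent) ∧
    (e.2.2.2.2 ∈ τ.matrix.closure ∧ e.2.2.2.2.Consistent) ∧
    RegionEdge A e.1 e.2.1 e.2.2.1 e.2.2.2}
  edges_states _ _ _ _ h := ⟨h.1, h.2.1⟩

end TimedReach

/-!
A configuration `⟨ℓ, ν⟩` of the automaton is split into the integer parts `υ` of the clocks, kept by
the counters, and the remainders `μ` in the unit cube, kept by the zone of the current matrix.

*Reduction to real matrices.* Evaluation of terms at `frac ν` is a strictly monotone map that
commutes with addition and integer constants (`TermClass.entryEmbedding_eval`). It therefore commutes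
with every operation on matrices, and every edge of the counter machine becomes an edge between
concrete real matrices (`EntryEmbedding.map_regionEdge`). A real bound is identified with the lower
set of the reals that obey it: the minimum of bounds is the intersection and the sum of bounds is
the Minkowski sum.

*From the machine to the automaton.* A matrix is `Tight` if its diagonal is `(≤, 0)`, the triangle
inequality holds and all clocks are nonnegative. The edges of the machine preserve tightness as long
as the zones are consistent: the constraints on them involve a single clock, so an inconsistency is
visible in the entry `(0, 0)`, and whether this entry admits `0` depends on the type only
(`EntryEmbedding.holds_zero_map_iff`). For tight matrices resets and delays can be undone on zones,
by eliminating the variable `xᵢ` or `x₀` from a system of difference constraints: a finite family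
of lower sets and a finite family of upper sets of reals have a common point if they meet pairwise
(`exists_mem_lower_upper`). So every point of the last zone is reached by a run of the automaton
(`reachable_of_regionMachine_reachable`).

*From the automaton to the machine.* The points of the zones are carried along by the symbolic
operations. A delay is cut at the times when some clock reaches an integer; between these times it
stays in the unit cube, and at them the clocks with remainder `1` are wrapped one after the other
(`Represented.delay`). A discrete step satisfies some disjunct of its guard, which splits into an
integer and a fractional part because all remainders are below `1` (`Represented.discrete`). All
zones met on the way contain a point, so consistency comes for free.
-/

namespace TimedReach

/-! ### Bounds as lower sets of reals -/

namespace Bound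

theorem isLowerSet_holds (b : Bound ℝ) : IsLowerSet {x | b.Holds x} := by
  intro x y hyx hx
  rcases b with ⟨_ | _, m⟩ | _
  · exact lt_of_le_of_lt hyx hx
  · exact le_trans hyx hx
  · trivial

/-- The order on bounds is inclusion of lower sets, so their minimum is the intersection. -/
theorem holds_min {a b : Bound ℝ} {x : ℝ} : (a.min b).Holds x ↔ a.Holds x ∧ b.Holds x := by
  have key : (a.Le b → a.Holds x → b.Holds x) ∧ (¬ a.Le b → b.Holds x → a.Holds x) := by
    rcases a with ⟨_ | _, m⟩ | _ <;> rcases b with ⟨_ | _, m'⟩ | _ <;>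
      simp [Le, Holds, Ineq.Holds, ← le_iff_lt_or_eq] <;> grind
  unfold min
  split_ifs with h
  · exact ⟨fun hx => ⟨hx, key.1 h hx⟩, And.left⟩
  · exact ⟨fun hx => ⟨key.2 h hx, hx⟩, And.right⟩

/-- Addition of bounds is the Minkowski sum of the corresponding lower sets. -/
theorem holds_add {a b : Bound ℝ} {x : ℝ} :
    (a.add b).Holds x ↔ ∃ y, a.Holds y ∧ b.Holds (x - y) := by
  rcases a with ⟨r, m⟩ | _
  · rcases b with ⟨r', m'⟩ | _
    · constructor
      · intro h
        -- The slack `m + m' - x` is shared equally between the two summands.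
        refine ⟨m - (m + m' - x) / 2, ?_⟩
        rcases r <;> rcases r' <;> simp only [add, Ineq.add, Holds, Ineq.Holds] at h ⊢ <;>
          constructor <;> linarith
      · rintro ⟨y, h, h'⟩
        rcases r <;> rcases r' <;> simp only [add, Ineq.add, Holds, Ineq.Holds] at h h' ⊢ <;>
          linarith
    · refine ⟨fun _ => ⟨m - 1, ?_, trivial⟩, fun _ => trivial⟩
      rcases r <;> simp [Holds, Ineq.Holds]
  · refine ⟨fun _ => ?_, fun _ => trivial⟩
    rcases b with ⟨r', m'⟩ | _
    · refine ⟨x - m' + 1, trivial, ?_⟩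
      rcases r' <;> simp only [Holds, Ineq.Holds] <;> linarith
    · exact ⟨0, trivial, trivial⟩

end Bound

/-! ### Change of the domain of entries -/

/-- Maps of entries that commute with all operations on difference bound matrices. -/
structure EntryEmbedding {α β : Type*} [LinearOrder α] [Add α] [IntCast α] [LinearOrder β] [Add β]
    [IntCast β] (f : α → β) : Prop where
  strictMono : StrictMono f
  map_add : ∀ a b, f (a + b) = f a + f b
  map_intCast : ∀ c : ℤ, f c = c

namespace EntryEmbedding

variable {α β : Type*} [LinearOrder α] [Add α] [IntCast α] [LinearOrder β] [Add β] [IntCast β]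
  {f : α → β} {n : ℕ}

theorem map_bound_add (hf : EntryEmbedding f) (a b : Bound α) :
    (a.add b).map f = (a.map f).add (b.map f) := by
  rcases a with ⟨r, m⟩ | _ <;> rcases b with ⟨r', m'⟩ | _ <;>
    simp [Bound.add, Bound.map, hf.map_add]

theorem map_bound_le (hf : EntryEmbedding f) (a b : Bound α) :
    (a.map f).Le (b.map f) ↔ a.Le b := by
  rcases a with ⟨r, m⟩ | _ <;> rcases b with ⟨r', m'⟩ | _ <;>
    simp [Bound.Le, Bound.map, hf.strictMono.lt_iff_lt, hf.strictMono.injective.eq_iff]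

theorem map_bound_min (hf : EntryEmbedding f) (a b : Bound α) :
    (a.min b).map f = (a.map f).min (b.map f) := by
  unfold Bound.min
  have h := hf.map_bound_le a b
  by_cases hab : a.Le b
  · rw [if_pos hab, if_pos (h.2 hab)]
  · rw [if_neg hab, if_neg (mt h.1 hab)]

theorem map_meet (hf : EntryEmbedding f) (M : DBM α n) (a : Atom n) :
    (M.meet a).map f = (M.map f).meet a := by
  funext i j
  simp only [DBM.map, DBM.meet, hf.map_bound_min, hf.map_bound_add]
  simp [Bound.map, hf.map_intCast]

theorem map_meetAll (hf : EntryEmbedding f) (M : DBM α n) (as : List (Atom n)) :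
    (M.meetAll as).map f = (M.map f).meetAll as := by
  unfold DBM.meetAll
  induction as generalizing M with
  | nil => rfl
  | cons a as ih => simp only [List.foldl_cons, ih, hf.map_meet]

theorem map_unitElapse (hf : EntryEmbedding f) (M : DBM α n) :
    M.unitElapse.map f = (M.map f).unitElapse := by
  unfold DBM.unitElapse
  rw [hf.map_meetAll]
  congr 1
  funext i j
  simp only [DBM.map, DBM.elapse]
  split_ifs <;> rfl

theorem map_wrap (hf : EntryEmbedding f) (M : DBM α n) (i : Fin (n + 1)) :
    (M.wrap i).map f = (M.map f).wrap i := by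
  unfold DBM.wrap
  rw [← hf.map_meetAll]
  rfl

theorem map_regionEdge {L : Type*} {A : TimedAutomaton L n} (hf : EntryEmbedding f)
    {p q : L × DBM α n} {g : CounterGuard n} {o : CounterOp n} (h : RegionEdge A p g o q) :
    RegionEdge A (p.1, p.2.map f) g o (q.1, q.2.map f) := by
  cases h with
  | delay ℓ M => rw [hf.map_unitElapse]; exact .delay ..
  | wrap ℓ M x => rw [hf.map_wrap]; exact .wrap ..
  | discreteReset e he x hx d hd M =>
    have : ((M.meetAll (BasicGuard.conjFrac d)).reset x.succ).map f =
        ((M.map f).meetAll (BasicGuard.conjFrac d)).reset x.succ := by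
      rw [← hf.map_meetAll]; rfl
    rw [this]
    exact .discreteReset e he x hx d hd _
  | discreteNop e he hx d hd M =>
    rw [hf.map_meetAll]
    exact .discreteNop e he hx d hd _

/-- Whether a real instance of a bound admits `0` does not depend on the instance. -/
theorem holds_zero_map_iff {f : α → ℝ} (hf : EntryEmbedding f) (b : Bound α) :
    (b.map f).Holds 0 ↔ (Bound.fin .le ((0 : ℤ) : α)).Le b := by
  rw [← hf.map_bound_le]
  rcases b with ⟨_ | _, m⟩ | _ <;>
    simp [Bound.map, Bound.Holds, Ineq.Holds, Bound.Le, hf.map_intCast, le_iff_lt_or_eq]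

end EntryEmbedding

/-- Evaluation at a valuation of the type reflects the order of the classes, so passing to an
instance commutes with the symbolic operations. -/
theorem TermClass.entryEmbedding_eval {n : ℕ} {τ : NType n} (ν : Valuation n)
    (hν : typeOf ν = τ.carrier) : EntryEmbedding (TermClass.eval ν hν) where
  strictMono := by
    refine (OrderEmbedding.ofMapLEIff (TermClass.eval ν hν) fun a b => ?_).strictMono
    induction a using Quotient.ind with | _ t =>
    induction b using Quotient.ind with | _ u =>
    exact (τ.mem_iff hν t u).symm
  map_add a b := by
    induction a using Quotient.ind with | _ t =>
    induction b using Quotient.ind with | _ u =>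
    rfl
  map_intCast c := by
    change (((c : ℚ) : ℝ)) = c
    norm_cast

/-- The edges of the region automaton stay inside a closure. -/
theorem RegionEdge.mem_closure {L α : Type*} [LinearOrder α] [Add α] [IntCast α] {n : ℕ}
    {A : TimedAutomaton L n} (hlast : A.NeverResetsLast) {M₀ : DBM α n} {p q : L × DBM α n}
    {g : CounterGuard n} {o : CounterOp n} (h : RegionEdge A p g o q) (hp : p.2 ∈ M₀.closure) :
    q.2 ∈ M₀.closure := by
  have hmeet : ∀ (as : List (Atom n)) (N : DBM α n), N ∈ M₀.closure →
      N.meetAll as ∈ M₀.closure := by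
    intro as
    induction as with
    | nil => exact fun N hN => hN
    | cons a as ih => exact fun N hN => ih _ (.meet N a hN)
  cases h with
  | delay ℓ M => exact .elapse _ hp
  | wrap ℓ M x =>
    by_cases hx : (x.succ : ℕ) < n
    · exact .reset _ _ hx (hmeet _ _ hp)
    · have : x.succ = Fin.last n := by
        apply Fin.ext
        simp only [Fin.val_last]
        have := x.succ.isLt
        omega
      rw [this]
      exact .wrap _ hp
  | discreteReset e he x hx d hd M =>
    have h1 : (x : ℕ) + 1 ≠ n := hlast e he x (by simp [hx])
    have h2 := x.isLt
    refine .reset _ _ ?_ (hmeet _ _ hp)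
    simp only [Fin.val_succ]
    omega
  | discreteNop e he hx d hd M => exact hmeet _ _ hp

/-! ### Operations on zones -/

namespace Valuation

variable {n : ℕ} (μ : Valuation n)

@[simp] theorem ext_zero : μ.ext 0 = 0 := rfl

@[simp] theorem ext_succ (x : Fin n) : μ.ext x.succ = μ x := rfl

theorem ext_nonneg (i : Fin (n + 1)) : 0 ≤ μ.ext i := by
  cases i using Fin.cases <;> simp

theorem ext_delay (d : ℝ≥0) {i : Fin (n + 1)} (hi : i ≠ 0) : (μ.delay d).ext i = μ.ext i + d := by
  cases i using Fin.cases with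
  | zero => exact absurd rfl hi
  | succ x => simp [delay]

theorem ext_reset (x : Fin n) (i : Fin (n + 1)) :
    (μ.reset {x}).ext i = μ.ext (if i = x.succ then 0 else i) := by
  cases i using Fin.cases with
  | zero => simp [(Fin.succ_ne_zero x).symm]
  | succ y => by_cases h : y = x <;> simp [reset, h]

end Valuation

/-- The valuation satisfies the difference constraint. -/
def Atom.Holds {n : ℕ} (a : Atom n) (μ : Valuation n) : Prop :=
  a.rel.Holds (μ.ext a.p - μ.ext a.q) a.c

/-- The constraint involves `x₀`, so that it bounds a single clock. -/
def Atom.IsBound {n : ℕ} (a : Atom n) : Prop := a.p = 0 ∨ a.q = 0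

namespace DBM

variable {n : ℕ} {M : DBM ℝ n} {μ : Valuation n}

theorem mem_zone_meet (hμ : μ ∈ M.zone) {a : Atom n} (ha : a.Holds μ) : μ ∈ (M.meet a).zone := by
  intro i j
  refine Bound.holds_min.2 ⟨hμ i j, ?_⟩
  simp only [Bound.holds_add]
  refine ⟨μ.ext i - μ.ext a.q, ⟨μ.ext i - μ.ext a.p, hμ i a.p, ?_⟩, ?_⟩
  · have : μ.ext i - μ.ext a.q - (μ.ext i - μ.ext a.p) = μ.ext a.p - μ.ext a.q := by ring
    rw [this]
    exact ha
  · have : μ.ext i - μ.ext j - (μ.ext i - μ.ext a.q) = μ.ext a.q - μ.ext j := by ring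
    rw [this]
    exact hμ a.q j

theorem mem_zone_meetAll (hμ : μ ∈ M.zone) {as : List (Atom n)} (has : ∀ a ∈ as, a.Holds μ) :
    μ ∈ (M.meetAll as).zone := by
  unfold meetAll
  induction as generalizing M with
  | nil => exact hμ
  | cons a as ih =>
    exact ih (mem_zone_meet hμ (has a (by simp))) fun b hb => has b (by simp [hb])

theorem mem_zone_elapse (hμ : μ ∈ M.zone) (d : ℝ≥0) : μ.delay d ∈ M.elapse.zone := by
  intro i j
  unfold elapse
  split_ifs with h
  · trivial
  · have h' := hμ i j
    refine Bound.isLowerSet_holds _ ?_ h'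
    by_cases hi : i = 0 <;> by_cases hj : j = 0
    · simp [hi, hj]
    · simp only [hi, Valuation.ext_zero, Valuation.ext_delay _ _ hj]
      linarith [d.coe_nonneg]
    · exact absurd ⟨hi, hj⟩ h
    · simp [Valuation.ext_delay _ _ hi, Valuation.ext_delay _ _ hj]

theorem mem_zone_unitElapse (hμ : μ ∈ M.zone) {d : ℝ≥0} (hd : ∀ x, μ x + d ≤ 1) :
    μ.delay d ∈ M.unitElapse.zone := by
  refine mem_zone_meetAll (mem_zone_elapse hμ d) fun a ha => ?_
  obtain ⟨x, rfl⟩ := List.mem_ofFn.1 ha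
  have : ((μ x + d : ℝ≥0) : ℝ) ≤ 1 := by exact_mod_cast hd x
  simpa [Atom.Holds, Ineq.Holds, Valuation.delay] using this

theorem mem_zone_reset (hμ : μ ∈ M.zone) (x : Fin n) : μ.reset {x} ∈ (M.reset x.succ).zone := by
  intro i j
  rw [Valuation.ext_reset, Valuation.ext_reset]
  exact hμ _ _

theorem mem_zone_wrap (hμ : μ ∈ M.zone) {x : Fin n} (hx : μ x = 1) :
    μ.reset {x} ∈ (M.wrap x.succ).zone := by
  refine mem_zone_reset (mem_zone_meetAll hμ ?_) x
  simp [Atom.Holds, Ineq.Holds, hx]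

/-! ### Tight matrices -/

/-- A tight matrix: the diagonal is `(≤, 0)`, the triangle inequality holds, and every clock is
bounded below by `0`. Inequalities between bounds are expressed as inclusions of lower sets. -/
structure Tight (M : DBM ℝ n) : Prop where
  diag : ∀ i x, (M i i).Holds x ↔ x ≤ 0
  triangle : ∀ i j k x, (M i j).Holds x → ∃ y, (M i k).Holds y ∧ (M k j).Holds (x - y)
  nonneg : ∀ i x, (M 0 i).Holds x → x ≤ 0

theorem holds_of_holds_meet {a : Atom n} {i j : Fin (n + 1)} {x : ℝ}
    (h : (M.meet a i j).Holds x) : (M i j).Holds x := (Bound.holds_min.1 h).1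

theorem holds_of_holds_meetAll {as : List (Atom n)} {i j : Fin (n + 1)} {x : ℝ}
    (h : (M.meetAll as i j).Holds x) : (M i j).Holds x := by
  unfold meetAll at h
  induction as generalizing M with
  | nil => exact h
  | cons a as ih => exact holds_of_holds_meet (ih h)

/-- The bound on `xᵢ - xⱼ` that is obtained by passing through the constraint, as a lower set. -/
theorem holds_through {a : Atom n} {i j : Fin (n + 1)} {x : ℝ} :
    (((M i a.p).add (.fin a.rel (a.c : ℝ))).add (M a.q j)).Holds x ↔
      ∃ y z, (M i a.p).Holds y ∧ a.rel.Holds z a.c ∧ (M a.q j).Holds (x - y - z) := by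
  simp only [Bound.holds_add]
  constructor
  · rintro ⟨w, ⟨y, hy, hz⟩, h⟩
    exact ⟨y, w - y, hy, hz, by convert h using 1; ring⟩
  · rintro ⟨y, z, hy, hz, h⟩
    refine ⟨y + z, ⟨y, hy, ?_⟩, by convert h using 1; ring⟩
    rw [add_sub_cancel_left]
    exact hz

theorem holds_meet {a : Atom n} {i j : Fin (n + 1)} {x : ℝ} :
    (M.meet a i j).Holds x ↔ (M i j).Holds x ∧
      ∃ y z, (M i a.p).Holds y ∧ a.rel.Holds z a.c ∧ (M a.q j).Holds (x - y - z) := by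
  rw [DBM.meet, Bound.holds_min, holds_through]

/-- Each entry of an intersection is either the old entry or the one obtained by passing through
the constraint. -/
theorem meet_holds_cases (M : DBM ℝ n) (a : Atom n) (i j : Fin (n + 1)) :
    (∀ x, (M.meet a i j).Holds x ↔ (M i j).Holds x) ∨
    (∀ x, (M.meet a i j).Holds x ↔
      ∃ y z, (M i a.p).Holds y ∧ a.rel.Holds z a.c ∧ (M a.q j).Holds (x - y - z)) := by
  have total := (Bound.isLowerSet_holds (M i j)).total
    (Bound.isLowerSet_holds (((M i a.p).add (.fin a.rel (a.c : ℝ))).add (M a.q j)))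
  refine total.imp (fun ht x => ?_) (fun ht x => ?_)
  · rw [DBM.meet, Bound.holds_min]
    exact ⟨And.left, fun hx => ⟨hx, ht hx⟩⟩
  · rw [DBM.meet, Bound.holds_min, ← holds_through]
    exact ⟨And.right, fun hx => ⟨ht hx, hx⟩⟩

namespace Tight

theorem mem_zone_meet_iff (hM : M.Tight) {a : Atom n} :
    μ ∈ (M.meet a).zone ↔ μ ∈ M.zone ∧ a.Holds μ := by
  refine ⟨fun h => ⟨fun i j => holds_of_holds_meet (h i j), ?_⟩, fun h => mem_zone_meet h.1 h.2⟩
  obtain ⟨-, y, z, hy, hz, h'⟩ := holds_meet.1 (h a.p a.q)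
  rw [hM.diag] at hy h'
  refine Bound.isLowerSet_holds (.fin a.rel (a.c : ℝ)) ?_ hz
  linarith

/-- For a constraint on a single clock, inconsistency of the intersection shows in the entry
`(0, 0)`; otherwise a single pass of tightening restores the triangle inequality. -/
theorem meet (hM : M.Tight) {a : Atom n} (ha : a.IsBound) (h0 : (M.meet a 0 0).Holds 0) :
    (M.meet a).Tight := by
  -- The constraint is compatible with the bound on the opposite difference.
  obtain ⟨b, f, hb, hf, hbf⟩ : ∃ b f, a.rel.Holds b a.c ∧ (M a.q a.p).Holds f ∧ b + f = 0 := by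
    obtain ⟨-, y, z, hy, hz, h⟩ := holds_meet.1 h0
    rcases ha with ha | ha
    · rw [ha] at hy ⊢
      rw [hM.diag] at hy
      exact ⟨z, -z, hz, Bound.isLowerSet_holds _ (by linarith) h, by ring⟩
    · rw [ha] at h ⊢
      rw [hM.diag] at h
      exact ⟨z, -z, hz, Bound.isLowerSet_holds _ (by linarith) hy, by ring⟩
  refine ⟨fun i x => ⟨fun h => (hM.diag i x).1 (holds_of_holds_meet h), fun h => ?_⟩, ?_,
    fun i x h => hM.nonneg i x (holds_of_holds_meet h)⟩
  · obtain ⟨g, hg, hg'⟩ := hM.triangle _ _ i _ hf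
    refine holds_meet.2 ⟨(hM.diag i x).2 h, f - g, b, hg', hb, ?_⟩
    exact Bound.isLowerSet_holds _ (by linarith) hg
  · intro i j k x h
    obtain ⟨h, y, z, hy, hz, hw⟩ := holds_meet.1 h
    rcases meet_holds_cases M a i k with h1 | h1 <;> rcases meet_holds_cases M a k j with h2 | h2 <;>
      simp only [h1, h2]
    · exact hM.triangle i j k x h
    · obtain ⟨s, hs, hs'⟩ := hM.triangle _ _ k _ hy
      refine ⟨s, hs, y - s, z, hs', hz, ?_⟩
      convert hw using 1
      ring
    · obtain ⟨t, ht, ht'⟩ := hM.triangle _ _ k _ hw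
      refine ⟨y + z + t, ⟨y, z, hy, hz, ?_⟩, ?_⟩
      · convert ht using 1
        ring
      · convert ht' using 1
        ring
    · -- Both summands pass through the constraint: the round trip `b + f = 0` is inserted at `k`.
      obtain ⟨g, hg, hg'⟩ := hM.triangle _ _ k _ hf
      refine ⟨y + z + g, ⟨y, z, hy, hz, ?_⟩, f - g, b, hg', hb, ?_⟩
      · convert hg using 1
        ring
      · convert hw using 1
        linarith

/-- Intersection with constraints on single clocks is exact on zones and keeps tightness, unless the
entry `(0, 0)` reveals an inconsistency. -/
theorem meetAll (hM : M.Tight) {as : List (Atom n)} (has : ∀ a ∈ as, a.IsBound)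
    (h0 : (M.meetAll as 0 0).Holds 0) :
    (M.meetAll as).Tight ∧
      ∀ μ, μ ∈ (M.meetAll as).zone ↔ μ ∈ M.zone ∧ ∀ a ∈ as, a.Holds μ := by
  induction as generalizing M with
  | nil => exact ⟨hM, fun μ => by simp [DBM.meetAll]⟩
  | cons a as ih =>
    have h1 : ((M.meet a).meetAll as 0 0).Holds 0 := h0
    obtain ⟨h2, h3⟩ := ih (hM.meet (has a (by simp)) (holds_of_holds_meetAll h1))
      (fun b hb => has b (by simp [hb])) h1
    refine ⟨h2, fun μ => (h3 μ).trans ?_⟩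
    rw [hM.mem_zone_meet_iff, List.forall_mem_cons, and_assoc]

theorem elapse (hM : M.Tight) : M.elapse.Tight where
  diag i x := by
    have : ¬ (i ≠ 0 ∧ i = 0) := fun h => h.1 h.2
    simp only [DBM.elapse, if_neg this, hM.diag]
  triangle i j k x h := by
    unfold DBM.elapse at h ⊢
    obtain ⟨y₀, hy₀, -⟩ := hM.triangle k k j 0 ((hM.diag k 0).2 le_rfl)
    by_cases hi : i = 0
    · subst hi
      obtain ⟨y, hy, hy'⟩ := hM.triangle 0 j k x (by simpa using h)
      refine ⟨y, by simpa using hy, ?_⟩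
      split_ifs
      · trivial
      · exact hy'
    · by_cases hk : k = 0
      · by_cases hj : j = 0
        · exact ⟨x, by simp [hi, hk, Bound.Holds], by simp [hk, hj, hM.diag]⟩
        · -- The first summand is unbounded, so any element of the second one will do.
          refine ⟨x - y₀, by simp [hi, hk, Bound.Holds], ?_⟩
          rw [sub_sub_cancel]
          split_ifs
          · trivial
          · exact hy₀
      · by_cases hj : j = 0
        · obtain ⟨y, hy, -⟩ := hM.triangle i i k 0 ((hM.diag i 0).2 le_rfl)
          exact ⟨y, by simpa [hk] using hy, by simp [hk, hj, Bound.Holds]⟩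
        · simpa [hk, hj] using hM.triangle i j k x (by simpa [hj] using h)
  nonneg i x h := hM.nonneg i x (by simpa [DBM.elapse] using h)

theorem reset (hM : M.Tight) (l : Fin (n + 1)) : (M.reset l).Tight where
  diag _ := hM.diag _
  triangle _ _ _ := hM.triangle _ _ _
  nonneg i x h := hM.nonneg (if i = l then 0 else i) x (by simpa [DBM.reset] using h)

end Tight
end DBM

/-! ### Elimination of a variable -/

/-- A finite family of lower sets and a finite family of upper sets of reals have a common point
as soon as each of the former meets each of the latter. -/
theorem exists_mem_lower_upper {ι : Type*} [Finite ι] [Nonempty ι] {U V : ι → Set ℝ}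
    (hU : ∀ i, IsLowerSet (U i)) (hV : ∀ i, IsUpperSet (V i))
    (h : ∀ i j, ∃ v, v ∈ V i ∧ v ∈ U j) : ∃ v, ∀ i, v ∈ V i ∧ v ∈ U i := by
  -- Both families are chains, so each has a smallest member.
  have dU : Directed (fun s t : Set ℝ => t ⊆ s) U := fun i j =>
    ((hU i).total (hU j)).elim (fun h => ⟨i, subset_rfl, h⟩) fun h => ⟨j, h, subset_rfl⟩
  have dV : Directed (fun s t : Set ℝ => t ⊆ s) V := fun i j =>
    ((hV i).total (hV j)).elim (fun h => ⟨i, subset_rfl, h⟩) fun h => ⟨j, h, subset_rfl⟩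
  have : IsTrans (Set ℝ) fun s t => t ⊆ s := ⟨fun _ _ _ h h' => h'.trans h⟩
  obtain ⟨j, hj⟩ := dU.finite_le id
  obtain ⟨i, hi⟩ := dV.finite_le id
  obtain ⟨v, hv, hv'⟩ := h i j
  exact ⟨v, fun k => ⟨hi k hv, hj k hv'⟩⟩

namespace DBM

variable {n : ℕ} {M : DBM ℝ n} {μ : Valuation n}

theorem isLowerSet_setOf_sub_holds (b : Bound ℝ) (c : ℝ) :
    IsLowerSet {v | b.Holds (v - c)} :=
  fun _ _ h hx => Bound.isLowerSet_holds b (sub_le_sub_right h c) hx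

theorem isUpperSet_setOf_sub_holds (b : Bound ℝ) (c : ℝ) :
    IsUpperSet {v | b.Holds (c - v)} :=
  fun _ _ h hx => Bound.isLowerSet_holds b (sub_le_sub_left h c) hx

namespace Tight

/-- Undoing a reset amounts to eliminating the variable that was reset. -/
theorem exists_of_mem_zone_reset (hM : M.Tight) (x : Fin n) (hμ : μ ∈ (M.reset x.succ).zone) :
    ∃ μ' ∈ M.zone, μ = μ'.reset {x} := by
  set σ : Fin (n + 1) → Fin (n + 1) := fun i => if i = x.succ then 0 else i with hσ
  have hσx : ∀ i, σ i ≠ x.succ := by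
    intro i
    simp only [hσ]
    split_ifs with h
    · exact (Fin.succ_ne_zero x).symm
    · exact h
  have hσσ : ∀ i, i ≠ x.succ → σ i = i := fun i hi => if_neg hi
  have H : ∀ i j, (M (σ i) (σ j)).Holds (μ.ext (σ i) - μ.ext (σ j)) := by
    intro i j
    have h : (M (σ (σ i)) (σ (σ j))).Holds (μ.ext (σ i) - μ.ext (σ j)) := hμ (σ i) (σ j)
    rwa [hσσ _ (hσx i), hσσ _ (hσx j)] at h
  have hμx : μ x = 0 := by
    have h : (M (σ x.succ) (σ 0)).Holds (μ.ext x.succ - μ.ext 0) := hμ x.succ 0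
    have h1 : σ x.succ = 0 := if_pos rfl
    have h2 : σ 0 = 0 := hσσ _ (Fin.succ_ne_zero x).symm
    rw [h1, h2, hM.diag] at h
    have h3 : (μ x : ℝ) ≤ 0 := by simpa using h
    exact le_antisymm (by exact_mod_cast h3) zero_le
  -- The value `v` of the eliminated clock has to obey its bounds against the other variables; the
  -- index `x.succ` repeats the bounds against `x₀`.
  obtain ⟨v, hv⟩ := exists_mem_lower_upper
    (U := fun j => {v | (M x.succ (σ j)).Holds (v - μ.ext (σ j))})
    (V := fun i => {v | (M (σ i) x.succ).Holds (μ.ext (σ i) - v)})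
    (fun j => isLowerSet_setOf_sub_holds _ _) (fun i => isUpperSet_setOf_sub_holds _ _)
    (by
      intro i j
      obtain ⟨y, hy, hy'⟩ := hM.triangle _ _ x.succ _ (H i j)
      refine ⟨μ.ext (σ i) - y, ?_, ?_⟩
      · simpa using hy
      · simpa [sub_right_comm] using hy')
  have hv0 : 0 ≤ v := by
    have h := (hv 0).1
    simp only [hσσ 0 (Fin.succ_ne_zero x).symm] at h
    have := hM.nonneg _ _ h
    simpa using this
  let μ' : Valuation n := fun y => if y = x then ⟨v, hv0⟩ else μ y
  have ext_x : μ'.ext x.succ = v := by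
    have h : μ' x = ⟨v, hv0⟩ := if_pos rfl
    rw [Valuation.ext_succ, h]
    rfl
  have ext_ne : ∀ i, i ≠ x.succ → μ'.ext i = μ.ext i := by
    intro i hi
    cases i using Fin.cases with
    | zero => rfl
    | succ y =>
      have : y ≠ x := fun h => hi (by rw [h])
      simp [μ', this]
  refine ⟨μ', fun i j => ?_, ?_⟩
  · by_cases hi : i = x.succ <;> by_cases hj : j = x.succ
    · rw [hi, hj, hM.diag, sub_self]
    · rw [hi, ext_x, ext_ne j hj]
      simpa [hσσ j hj] using (hv j).2
    · rw [hj, ext_x, ext_ne i hi]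
      simpa [hσσ i hi] using (hv i).1
    · rw [ext_ne i hi, ext_ne j hj]
      simpa [hσσ i hi, hσσ j hj] using H i j
  · funext y
    by_cases hy : y = x
    · simp [Valuation.reset, hy, hμx]
    · simp [Valuation.reset, hy, μ']

/-- Going back in time amounts to eliminating the variable `x₀`. -/
theorem exists_of_mem_zone_elapse (hM : M.Tight) (hμ : μ ∈ M.elapse.zone) :
    ∃ μ' ∈ M.zone, ∃ d, μ = μ'.delay d := by
  have H : ∀ i j, i = 0 ∨ j ≠ 0 → (M i j).Holds (μ.ext i - μ.ext j) := by
    intro i j hij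
    have : ¬ (i ≠ 0 ∧ j = 0) := fun h => hij.elim h.1 (fun h' => h' h.2)
    simpa only [DBM.elapse, if_neg this] using hμ i j
  -- The value `v` of `x₀` is the length of the delay; the index `0` stands for `0 ≤ v`.
  obtain ⟨v, hv⟩ := exists_mem_lower_upper
    (U := fun j => {v | j ≠ 0 → (M 0 j).Holds (v - μ.ext j)})
    (V := fun i => {v | if i = 0 then 0 ≤ v else (M i 0).Holds (μ.ext i - v)})
    (fun j v w h hv hj => isLowerSet_setOf_sub_holds _ _ h (hv hj))
    (by
      intro i v w h hv
      simp only [Set.mem_ofPred_eq] at hv ⊢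
      split_ifs at hv ⊢
      · exact hv.trans h
      · exact isUpperSet_setOf_sub_holds _ _ h hv)
    (by
      intro i j
      by_cases hi : i = 0
      · exact ⟨0, by simp [hi], fun hj => by simpa using H 0 j (.inl rfl)⟩
      · by_cases hj : j = 0
        · obtain ⟨y, hy, -⟩ := hM.triangle i i 0 0 ((hM.diag i 0).2 le_rfl)
          exact ⟨μ.ext i - y, by simpa [hi] using hy, fun h => absurd hj h⟩
        · obtain ⟨y, hy, hy'⟩ := hM.triangle i j 0 _ (H i j (.inr hj))
          exact ⟨μ.ext i - y, by simpa [hi] using hy, fun _ => by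
            simpa [sub_right_comm] using hy'⟩)
  have hv0 : 0 ≤ v := by simpa using (hv 0).1
  have hle : ∀ x : Fin n, v ≤ μ x := by
    intro x
    have := hM.nonneg _ _ ((hv x.succ).2 (Fin.succ_ne_zero x))
    simpa using this
  let μ' : Valuation n := fun x => ⟨μ x - v, sub_nonneg.2 (hle x)⟩
  have ext_ne : ∀ i, i ≠ 0 → μ'.ext i = μ.ext i - v := by
    intro i hi
    cases i using Fin.cases with
    | zero => exact absurd rfl hi
    | succ y => rfl
  refine ⟨μ', fun i j => ?_, ⟨v, hv0⟩, ?_⟩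
  · by_cases hi : i = 0 <;> by_cases hj : j = 0
    · rw [hi, hj, hM.diag, sub_self]
    · have := (hv j).2 hj
      rw [hi, ext_ne j hj]
      simpa using this
    · have := (hv i).1
      simp only [Set.mem_ofPred_eq, if_neg hi] at this
      rw [hj, ext_ne i hi]
      simpa using this
    · rw [ext_ne i hi, ext_ne j hj]
      simpa using H i j (.inr hj)
  · funext x
    exact NNReal.eq (sub_add_cancel (μ x : ℝ) v).symm

end Tight
end DBM

/-! ### Integer and fractional parts -/

namespace Valuation

variable {n : ℕ}

/-- The valuation with counters `υ` as integer parts and remainders `μ`. -/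
def combine (υ : Fin n → ℕ) (μ : Valuation n) : Valuation n := fun x => υ x + μ x

theorem combine_floor_frac (ν : Valuation n) : combine ν.floor ν.frac = ν := by
  funext x
  apply NNReal.eq
  have h : (⌊ν x⌋₊ : ℝ) = ⌊(ν x : ℝ)⌋ :=
    natCast_floor_eq_intCast_floor (R := ℝ) (ν x).coe_nonneg
  change (⌊ν x⌋₊ : ℝ) + Int.fract (ν x : ℝ) = ν x
  rw [h]
  exact Int.floor_add_fract _

theorem frac_lt_one (ν : Valuation n) (x : Fin n) : ν.frac x < 1 := by
  rw [← NNReal.coe_lt_coe]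
  exact Int.fract_lt_one _

theorem floor_combine (υ : Fin n → ℕ) {μ : Valuation n} (hμ : ∀ x, μ x < 1) :
    (combine υ μ).floor = υ := by
  funext x
  rw [floor, Nat.floor_eq_iff zero_le]
  exact ⟨le_self_add, add_lt_add_right (hμ x) _⟩

theorem frac_combine (υ : Fin n → ℕ) {μ : Valuation n} (hμ : ∀ x, μ x < 1) :
    (combine υ μ).frac = μ := by
  have h := combine_floor_frac (combine υ μ)
  rw [floor_combine υ hμ] at h
  funext x
  exact add_left_cancel (congrFun h x)

theorem combine_delay (υ : Fin n → ℕ) (μ : Valuation n) (d : ℝ≥0) :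
    combine υ (μ.delay d) = (combine υ μ).delay d := by
  funext x
  simp [combine, delay, add_assoc]

theorem combine_reset (υ : Fin n → ℕ) (μ : Valuation n) (x : Fin n) :
    combine (Function.update υ x 0) (μ.reset {x}) = (combine υ μ).reset {x} := by
  funext y
  by_cases hy : y = x
  · subst hy
    simp [combine, reset]
  · simp [combine, reset, hy]

theorem combine_wrap (υ : Fin n → ℕ) {μ : Valuation n} {x : Fin n} (hx : μ x = 1) :
    combine (Function.update υ x (υ x + 1)) (μ.reset {x}) = combine υ μ := by
  funext y
  by_cases hy : y = x
  · subst hy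
    simp [combine, reset, hx]
  · simp [combine, reset, hy]

@[simp] theorem reset_empty (μ : Valuation n) : μ.reset ∅ = μ := by
  funext x
  simp [reset]

end Valuation

open TimedReach.Valuation

/-! ### Guards -/

/-- Satisfaction of basic guards. -/
def BasicGuard.Sat {n : ℕ} (ν : Valuation n) : BasicGuard n → Prop
  | .lt x k => ν x < k
  | .eq x k => ν x = k
  | .between x k => (k : ℝ≥0) < ν x ∧ ν x < k + 1
  | .ge x k => (k : ℝ≥0) ≤ ν x

theorem ClockConstraint.sat_iff_dnf {n : ℕ} (ν : Valuation n) (φ : ClockConstraint n) :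
    φ.Sat ν ↔ ∃ d ∈ φ.dnf, ∀ b ∈ d, b.Sat ν := by
  induction φ with
  | tt => simp [Sat, dnf]
  | lt x k => simp [Sat, dnf, BasicGuard.Sat]
  | eq x k => simp [Sat, dnf, BasicGuard.Sat]
  | gt x k =>
    simp only [Sat, dnf, BasicGuard.Sat, List.mem_cons, List.not_mem_nil, or_false,
      exists_eq_or_imp, exists_eq_left, forall_eq, Nat.cast_add, Nat.cast_one]
    constructor
    · intro h
      exact (lt_or_ge (ν x) (k + 1)).imp (fun h' => ⟨h, h'⟩) id
    · rintro (h | h)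
      · exact h.1
      · exact lt_of_lt_of_le (lt_add_one _) h
  | and φ ψ ihφ ihψ =>
    simp only [Sat, dnf, ihφ, ihψ, List.mem_flatMap, List.mem_map]
    constructor
    · rintro ⟨⟨a, ha, ha'⟩, b, hb, hb'⟩
      refine ⟨a ++ b, ⟨a, ha, b, hb, rfl⟩, fun c hc => ?_⟩
      exact (List.mem_append.1 hc).elim (ha' c) (hb' c)
    · rintro ⟨-, ⟨a, ha, b, hb, rfl⟩, h⟩
      exact ⟨⟨a, ha, fun c hc => h c (by simp [hc])⟩, b, hb, fun c hc => h c (by simp [hc])⟩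

namespace BasicGuard

variable {n : ℕ}

theorem conjInt_sat {υ : Fin n → ℕ} {bs : List (BasicGuard n)} :
    (conjInt bs).Sat υ ↔ ∀ b ∈ bs, b.int.Sat υ := by
  induction bs with
  | nil => simp [conjInt, CounterGuard.Sat]
  | cons b bs ih =>
    rw [List.forall_mem_cons, ← ih]
    rfl

theorem forall_mem_conjFrac {bs : List (BasicGuard n)} {p : Atom n → Prop} :
    (∀ a ∈ conjFrac bs, p a) ↔ ∀ b ∈ bs, ∀ a ∈ b.frac, p a := by
  simp only [conjFrac, List.mem_flatMap]
  exact ⟨fun h b hb a ha => h a ⟨b, hb, ha⟩, fun h a ⟨b, hb, ha⟩ => h b hb a ha⟩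

theorem isBound_of_mem_conjFrac {bs : List (BasicGuard n)} : ∀ a ∈ conjFrac bs, a.IsBound := by
  refine forall_mem_conjFrac.2 fun b _ => ?_
  cases b <;> simp [frac, Atom.IsBound]

/-- The integer and the fractional part together imply the guard, even if a remainder is `1`. -/
theorem sat_combine {υ : Fin n → ℕ} {μ : Valuation n} {b : BasicGuard n} (hi : b.int.Sat υ)
    (hf : ∀ a ∈ b.frac, a.Holds μ) : b.Sat (combine υ μ) := by
  cases b with
  | lt x k =>
    have h1 : υ x + 1 ≤ k := by simpa [int, CounterGuard.Sat] using hi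
    have h2 : μ x < 1 := by simpa [frac, Atom.Holds, Ineq.Holds] using hf
    have h3 : (υ x : ℝ≥0) + 1 ≤ k := by exact_mod_cast h1
    exact lt_of_lt_of_le (by simpa [combine] using h2) h3
  | eq x k =>
    have h1 : υ x = k := by simpa [int, CounterGuard.Sat] using hi
    have h2 : (μ x : ℝ) ≤ 0 := by simpa [frac, Atom.Holds, Ineq.Holds] using hf
    have h2 : μ x = 0 := le_antisymm (by exact_mod_cast h2) zero_le
    simp [Sat, combine, h1, h2]
  | between x k =>
    have h1 : υ x = k := by simpa [int, CounterGuard.Sat] using hi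
    have h2 : 0 < μ x ∧ μ x < 1 := by simpa [frac, Atom.Holds, Ineq.Holds] using hf
    simpa [Sat, combine, h1] using h2
  | ge x k =>
    have h1 : k ≤ υ x := by
      have : (k : ℤ) - 1 < υ x := hi
      omega
    have h2 : (k : ℝ≥0) ≤ υ x := by exact_mod_cast h1
    exact h2.trans (by simp [combine])

theorem int_sat_and_frac_holds {υ : Fin n → ℕ} {μ : Valuation n} (hμ : ∀ x, μ x < 1)
    {b : BasicGuard n} (h : b.Sat (combine υ μ)) : b.int.Sat υ ∧ ∀ a ∈ b.frac, a.Holds μ := by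
  have hfloor : ∀ x, ⌊(υ x : ℝ≥0) + μ x⌋₊ = υ x := fun x =>
    congrFun (floor_combine υ hμ) x
  have hle : ∀ x, (υ x : ℝ≥0) ≤ υ x + μ x := fun x => le_self_add
  cases b with
  | lt x k =>
    have h1 : υ x < k := by exact_mod_cast (hle x).trans_lt h
    exact ⟨by simpa [int, CounterGuard.Sat] using h1,
      by simpa [frac, Atom.Holds, Ineq.Holds] using hμ x⟩
  | eq x k =>
    have h0 : (υ x : ℝ≥0) + μ x = k := h
    have h1 : υ x = k := by rw [← hfloor x, h0, Nat.floor_natCast]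
    have h2 : μ x = 0 := by simpa [h1] using h0
    exact ⟨by simpa [int, CounterGuard.Sat] using h1,
      by simp [frac, Atom.Holds, Ineq.Holds, h2]⟩
  | between x k =>
    have h0 : (k : ℝ≥0) < υ x + μ x ∧ υ x + μ x < k + 1 := h
    have h1 : υ x = k := by
      rw [← hfloor x, Nat.floor_eq_iff zero_le]
      exact ⟨h0.1.le, h0.2⟩
    have h2 : 0 < μ x := by simpa [h1] using h0.1
    exact ⟨by simpa [int, CounterGuard.Sat] using h1,
      by simpa [frac, Atom.Holds, Ineq.Holds] using ⟨h2, hμ x⟩⟩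
  | ge x k =>
    have h1 : k ≤ υ x := by
      rw [← hfloor x]
      exact Nat.le_floor h
    refine ⟨?_, by simp [frac, Atom.Holds, Ineq.Holds]⟩
    change (k : ℤ) - 1 < υ x
    omega

end BasicGuard

/-! ### From the counter machine to the automaton -/

/-- An edge whose target is consistent preserves tightness and can be undone on zones. -/
theorem RegionEdge.tight_and_reachable {L : Type*} {n : ℕ} {A : TimedAutomaton L n}
    {p q : L × DBM ℝ n} {g : CounterGuard n} {o : CounterOp n} (h : RegionEdge A p g o q)
    (hp : p.2.Tight) (h0 : (q.2 0 0).Holds 0) :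
    q.2.Tight ∧ ∀ υ, g.Sat υ → ∀ μ ∈ q.2.zone, ∃ μ₁ ∈ p.2.zone,
      A.Reachable (p.1, combine υ μ₁) (q.1, combine (o.apply υ) μ) := by
  cases h with
  | delay ℓ M =>
    obtain ⟨h1, h2⟩ := hp.elapse.meetAll (fun a ha => by
      obtain ⟨x, rfl⟩ := List.mem_ofFn.1 ha
      exact .inr rfl) h0
    refine ⟨h1, fun υ _ μ hμ => ?_⟩
    obtain ⟨μ₁, h3, d, rfl⟩ := hp.exists_of_mem_zone_elapse ((h2 μ).1 hμ).1
    refine ⟨μ₁, h3, .single ⟨d, ?_⟩⟩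
    rw [CounterOp.apply, combine_delay]
    exact .delay ..
  | wrap ℓ M x =>
    obtain ⟨h1, h2⟩ := hp.meetAll (as := [⟨x.succ, 0, .le, 1⟩, ⟨0, x.succ, .le, -1⟩])
      (by simp [Atom.IsBound]) h0
    refine ⟨h1.reset _, fun υ _ μ hμ => ?_⟩
    obtain ⟨μ₁, h3, rfl⟩ := h1.exists_of_mem_zone_reset x hμ
    obtain ⟨h4, h5⟩ := (h2 μ₁).1 h3
    have h6 : (μ₁ x : ℝ) ≤ 1 ∧ 1 ≤ (μ₁ x : ℝ) := by
      simpa [Atom.Holds, Ineq.Holds] using h5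
    have h7 : μ₁ x = 1 := NNReal.eq (le_antisymm h6.1 h6.2)
    refine ⟨μ₁, h4, ?_⟩
    rw [CounterOp.apply, combine_wrap υ h7]
    exact .refl
  | discreteReset e he x hx d hd M =>
    obtain ⟨h1, h2⟩ := hp.meetAll BasicGuard.isBound_of_mem_conjFrac h0
    refine ⟨h1.reset _, fun υ hυ μ hμ => ?_⟩
    obtain ⟨μ₁, h3, rfl⟩ := h1.exists_of_mem_zone_reset x hμ
    obtain ⟨h4, h5⟩ := (h2 μ₁).1 h3
    refine ⟨μ₁, h4, .single ⟨0, ?_⟩⟩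
    rw [CounterOp.apply, combine_reset, ← hx]
    refine .discrete e he _ ((ClockConstraint.sat_iff_dnf _ _).2 ⟨d, hd, fun b hb => ?_⟩)
    exact BasicGuard.sat_combine (BasicGuard.conjInt_sat.1 hυ b hb)
      (BasicGuard.forall_mem_conjFrac.1 h5 b hb)
  | discreteNop e he hx d hd M =>
    obtain ⟨h1, h2⟩ := hp.meetAll BasicGuard.isBound_of_mem_conjFrac h0
    refine ⟨h1, fun υ hυ μ hμ => ?_⟩
    obtain ⟨h4, h5⟩ := (h2 μ).1 hμ
    refine ⟨μ, h4, .single ⟨0, ?_⟩⟩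
    have h6 : combine υ μ = (combine υ μ).reset e.resets := by rw [hx, reset_empty]
    rw [CounterOp.apply]
    nth_rewrite 2 [h6]
    refine .discrete e he _ ((ClockConstraint.sat_iff_dnf _ _).2 ⟨d, hd, fun b hb => ?_⟩)
    exact BasicGuard.sat_combine (BasicGuard.conjInt_sat.1 hυ b hb)
      (BasicGuard.forall_mem_conjFrac.1 h5 b hb)

variable {n : ℕ} {τ : NType n} {ν : Valuation n}

theorem holds_inst_matrix_iff (hτ : typeOf ν = τ.carrier) (i j : Fin (n + 1)) (x : ℝ) :
    (PDBM.inst ν hτ τ.matrix i j).Holds x ↔ x ≤ ν.ext i - ν.ext j := Iff.rfl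

theorem tight_inst_matrix (hτ : typeOf ν = τ.carrier) : (PDBM.inst ν hτ τ.matrix).Tight where
  diag i x := by rw [holds_inst_matrix_iff, sub_self]
  triangle i j k x h := by
    simp only [holds_inst_matrix_iff] at h ⊢
    exact ⟨ν.ext i - ν.ext k, le_rfl, by linarith⟩
  nonneg i x h := by
    rw [holds_inst_matrix_iff, ext_zero] at h
    linarith [ν.ext_nonneg i]

theorem mem_zone_inst_matrix_iff (hτ : typeOf ν = τ.carrier) {μ : Valuation n} :
    μ ∈ (PDBM.inst ν hτ τ.matrix).zone ↔ μ = ν := by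
  constructor
  · intro h
    funext x
    have h1 := h x.succ 0
    have h2 := h 0 x.succ
    simp only [holds_inst_matrix_iff, ext_succ, ext_zero] at h1 h2
    exact NNReal.eq (by linarith)
  · rintro rfl i j
    rw [holds_inst_matrix_iff]

/-- Consistency at any valuation of the type makes the entry `(0, 0)` admit `0` at every other. -/
theorem PDBM.Consistent.holds_zero {M : PDBM τ} (hM : M.Consistent) (hτ : typeOf ν = τ.carrier) :
    (PDBM.inst ν hτ M 0 0).Holds 0 := by
  obtain ⟨ν₁, h₁, μ, hμ⟩ := hM
  have h := hμ 0 0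
  rw [sub_self] at h
  exact ((TermClass.entryEmbedding_eval ν hτ).holds_zero_map_iff _).2
    (((TermClass.entryEmbedding_eval ν₁ h₁).holds_zero_map_iff _).1 h)

/-- Every run of the counter machine to a consistent zone is realised, backwards from any point of
the zone, by a run of the automaton. -/
theorem reachable_of_regionMachine_reachable {L : Type*} {A : TimedAutomaton L n}
    (hτ : typeOf ν = τ.carrier) {ℓ : L} {υ₀ : Fin n → ℕ} {q : (L × PDBM τ) × (Fin n → ℕ)}
    (h : (regionMachine A τ).Reachable ((ℓ, τ.matrix), υ₀) q) :
    (PDBM.inst ν hτ q.1.2).Tight ∧ ∀ μ ∈ (PDBM.inst ν hτ q.1.2).zone,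
      A.Reachable (ℓ, combine υ₀ ν) (q.1.1, combine q.2 μ) := by
  induction h with
  | refl =>
    refine ⟨tight_inst_matrix hτ, fun μ hμ => ?_⟩
    rw [(mem_zone_inst_matrix_iff hτ).1 hμ]
    exact .refl
  | tail _ hstep ih =>
    obtain ⟨g, o, ⟨-, hc, he⟩, hg, ho⟩ := hstep
    obtain ⟨h1, h2⟩ := RegionEdge.tight_and_reachable
      ((TermClass.entryEmbedding_eval ν hτ).map_regionEdge he) ih.1 (hc.2.holds_zero hτ)
    refine ⟨h1, fun μ hμ => ?_⟩
    obtain ⟨μ₁, h3, h4⟩ := h2 _ hg μ hμ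
    rw [ho]
    exact (ih.2 μ₁ h3).trans h4

/-! ### From the automaton to the counter machine -/

/-- The configuration with location `ℓ`, integer parts `υ` and remainders `μ` is represented by a
configuration that the counter machine reaches from `((ℓ₀, M_τ), υ₀)`. Remainders equal to `1` are
allowed. -/
def Represented {L : Type*} (A : TimedAutomaton L n) (hτ : typeOf ν = τ.carrier) (ℓ₀ : L)
    (υ₀ : Fin n → ℕ) (ℓ : L) (υ : Fin n → ℕ) (μ : Valuation n) : Prop :=
  ∃ M ∈ τ.matrix.closure, (regionMachine A τ).Reachable ((ℓ₀, τ.matrix), υ₀) ((ℓ, M), υ) ∧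
    μ ∈ (PDBM.inst ν hτ M).zone

namespace Represented

variable {L : Type*} {A : TimedAutomaton L n} {hτ : typeOf ν = τ.carrier} {ℓ₀ ℓ ℓ' : L}
  {υ₀ υ : Fin n → ℕ} {μ : Valuation n}

theorem refl (hτ : typeOf ν = τ.carrier) : Represented A hτ ℓ₀ υ₀ ℓ₀ υ₀ ν :=
  ⟨τ.matrix, .base, .refl, (mem_zone_inst_matrix_iff hτ).2 rfl⟩

/-- A symbolic edge can be taken as soon as its target contains a point, since the closure and
consistency conditions on the target then hold. -/
theorem step (hlast : A.NeverResetsLast) (h : Represented A hτ ℓ₀ υ₀ ℓ υ μ) {g : CounterGuard n}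
    {o : CounterOp n} (hg : g.Sat υ) {μ' : Valuation n}
    (hedge : ∀ M : PDBM τ, μ ∈ (PDBM.inst ν hτ M).zone → ∃ N : PDBM τ,
      RegionEdge A (ℓ, M) g o (ℓ', N) ∧ μ' ∈ (PDBM.inst ν hτ N).zone) :
    Represented A hτ ℓ₀ υ₀ ℓ' (o.apply υ) μ' := by
  obtain ⟨M, hM, hr, hμ⟩ := h
  obtain ⟨N, he, hμ'⟩ := hedge M hμ
  have hN := he.mem_closure hlast hM
  exact ⟨N, hN, hr.tail ⟨g, o, ⟨⟨hM, ν, hτ, μ, hμ⟩, ⟨hN, ν, hτ, μ', hμ'⟩, he⟩, hg, rfl⟩, hμ'⟩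

theorem elapse (hlast : A.NeverResetsLast) (h : Represented A hτ ℓ₀ υ₀ ℓ υ μ) {d : ℝ≥0}
    (hd : ∀ x, μ x + d ≤ 1) : Represented A hτ ℓ₀ υ₀ ℓ υ (μ.delay d) := by
  refine h.step hlast (g := .tt) (o := .nop) trivial fun M hμ => ⟨_, .delay ℓ M, ?_⟩
  rw [PDBM.inst, (TermClass.entryEmbedding_eval ν hτ).map_unitElapse]
  exact DBM.mem_zone_unitElapse hμ hd

theorem wrap (hlast : A.NeverResetsLast) (h : Represented A hτ ℓ₀ υ₀ ℓ υ μ) {x : Fin n}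
    (hx : μ x = 1) :
    Represented A hτ ℓ₀ υ₀ ℓ (Function.update υ x (υ x + 1)) (μ.reset {x}) := by
  refine h.step hlast (g := .tt) (o := .inc x) trivial fun M hμ => ⟨_, .wrap ℓ M x, ?_⟩
  rw [PDBM.inst, (TermClass.entryEmbedding_eval ν hτ).map_wrap]
  exact DBM.mem_zone_wrap hμ hx

theorem wrap_finset (hlast : A.NeverResetsLast) (h : Represented A hτ ℓ₀ υ₀ ℓ υ μ)
    (s : Finset (Fin n)) (hs : ∀ x ∈ s, μ x = 1) :
    Represented A hτ ℓ₀ υ₀ ℓ (fun x => if x ∈ s then υ x + 1 else υ x) (μ.reset s) := by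
  induction s using Finset.induction_on with
  | empty => simpa using h
  | insert y s hy ih =>
    have h1 := (ih fun x hx => hs x (by simp [hx])).wrap hlast (x := y)
      (by simpa [reset, hy] using hs y (by simp))
    convert h1 using 1
    · funext x
      by_cases hxy : x = y
      · subst hxy
        simp [hy]
      · simp [hxy]
    · funext x
      by_cases hxy : x = y <;> simp [reset, hxy]

/-- A delay of arbitrary length is followed by alternating delays inside the unit cube, up to the
next time a clock reaches an integer, with the wrapping of the clocks that do. The number of
integer crossings that remain bounds the number of rounds. -/
theorem delay (hlast : A.NeverResetsLast) (h : Represented A hτ ℓ₀ υ₀ ℓ υ μ)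
    (hμ : ∀ x, μ x < 1) (d : ℝ≥0) :
    ∃ υ' μ', Represented A hτ ℓ₀ υ₀ ℓ υ' μ' ∧ (∀ x, μ' x < 1) ∧
      combine υ' μ' = (combine υ μ).delay d := by
  obtain ⟨N, hN⟩ : ∃ N, ∑ x, ⌊μ x + d⌋₊ = N := ⟨_, rfl⟩
  induction N using Nat.strong_induction_on generalizing υ μ d with
  | _ N ih =>
  by_cases hd : ∀ x, μ x + d < 1
  · exact ⟨υ, μ.delay d, h.elapse hlast fun x => (hd x).le, hd, combine_delay ..⟩
  · push Not at hd
    obtain ⟨x₁, hx₁⟩ := hd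
    have : Nonempty (Fin n) := ⟨x₁⟩
    obtain ⟨x₀, hx₀⟩ := Finite.exists_max μ
    -- The delay `δ` until the first clock reaches an integer.
    obtain ⟨δ, hδ⟩ := exists_add_of_le (hμ x₀).le
    have hδd : δ ≤ d := by
      have h1 : μ x₀ + δ ≤ μ x₀ + d := hδ ▸ hx₁.trans (add_le_add_left (hx₀ x₁) d)
      exact le_of_add_le_add_left h1
    obtain ⟨d', rfl⟩ := exists_add_of_le hδd
    have hle : ∀ x, μ x + δ ≤ 1 := fun x => hδ ▸ add_le_add_left (hx₀ x) δ
    set s : Finset (Fin n) := Finset.univ.filter fun x => μ x + δ = 1 with hs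
    have hmem : ∀ x, x ∈ s ↔ μ x + δ = 1 := by simp [hs]
    have hrep := (h.elapse hlast hle).wrap_finset hlast s fun x hx => (hmem x).1 hx
    have hval : ∀ x, ((μ.delay δ).reset s) x + (if x ∈ s then 1 else 0) = μ x + δ := by
      intro x
      by_cases hx : x ∈ s
      · simp [reset, hx, (hmem x).1 hx]
      · simp [reset, hx, Valuation.delay]
    have hlt : ∀ x, ((μ.delay δ).reset s) x < 1 := by
      intro x
      by_cases hx : x ∈ s
      · simp [reset, hx]
      · have h1 := lt_of_le_of_ne (hle x) (mt (hmem x).2 hx)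
        simpa [reset, hx, Valuation.delay] using h1
    have hfloor : ∀ x, ⌊((μ.delay δ).reset s) x + d'⌋₊ + (if x ∈ s then 1 else 0) =
        ⌊μ x + (δ + d')⌋₊ := by
      intro x
      rw [← add_assoc, ← hval x]
      by_cases hx : x ∈ s
      · rw [if_pos hx, if_pos hx, add_right_comm, Nat.floor_add_one zero_le]
      · rw [if_neg hx, if_neg hx, add_zero, add_zero]
    have hsum : ∑ x, ⌊((μ.delay δ).reset s) x + d'⌋₊ < N := by
      rw [← hN]
      refine Finset.sum_lt_sum (fun x _ => ?_) ⟨x₀, Finset.mem_univ _, ?_⟩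
      · rw [← hfloor x]
        exact Nat.le_add_right _ _
      · rw [← hfloor x₀, if_pos ((hmem x₀).2 hδ.symm)]
        exact Nat.lt_succ_self _
    obtain ⟨υ', μ', h1, h2, h3⟩ := ih _ hsum hrep hlt d' rfl
    refine ⟨υ', μ', h1, h2, h3.trans ?_⟩
    funext x
    have h4 := hval x
    simp only [combine, Valuation.delay] at h4 ⊢
    rw [add_assoc (υ x : ℝ≥0), ← add_assoc (μ x), ← h4]
    by_cases hx : x ∈ s
    · simp only [if_pos hx]
      push_cast
      ring
    · simp only [if_neg hx]
      ring

/-- Since all remainders are below `1`, the disjunct of the guard that holds splits into its integer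
and fractional parts. -/
theorem discrete (hlast : A.NeverResetsLast) (hone : A.ResetsAtMostOne) {e : Edge L n}
    (he : e ∈ A.edges) (h : Represented A hτ ℓ₀ υ₀ e.src υ μ) (hμ : ∀ x, μ x < 1)
    (hsat : e.guard.Sat (combine υ μ)) :
    ∃ υ' μ', Represented A hτ ℓ₀ υ₀ e.tgt υ' μ' ∧ (∀ x, μ' x < 1) ∧
      combine υ' μ' = (combine υ μ).reset e.resets := by
  obtain ⟨d, hd, hb⟩ := (ClockConstraint.sat_iff_dnf _ _).1 hsat
  have hparts := fun b hbd => BasicGuard.int_sat_and_frac_holds hμ (hb b hbd)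
  have hint := BasicGuard.conjInt_sat.2 fun b hbd => (hparts b hbd).1
  have hmeet : ∀ M : PDBM τ, μ ∈ (PDBM.inst ν hτ M).zone →
      μ ∈ (PDBM.inst ν hτ (M.meetAll (BasicGuard.conjFrac d))).zone := by
    intro M hM
    rw [PDBM.inst, (TermClass.entryEmbedding_eval ν hτ).map_meetAll]
    exact DBM.mem_zone_meetAll hM
      (BasicGuard.forall_mem_conjFrac.2 fun b hbd => (hparts b hbd).2)
  rcases Nat.le_one_iff_eq_zero_or_eq_one.1 (hone e he) with hc | hc
  · have hr := Finset.card_eq_zero.1 hc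
    refine ⟨υ, μ, h.step hlast (o := .nop) hint fun M hM =>
      ⟨_, .discreteNop e he hr d hd M, hmeet M hM⟩, hμ, ?_⟩
    rw [hr, reset_empty]
  · obtain ⟨x, hr⟩ := Finset.card_eq_one.1 hc
    refine ⟨_, μ.reset {x}, h.step hlast (o := .reset x) hint fun M hM =>
      ⟨_, .discreteReset e he x hr d hd M, DBM.mem_zone_reset (hmeet M hM) x⟩, fun y => ?_, ?_⟩
    · by_cases hy : y = x
      · simp [Valuation.reset, hy]
      · simpa [Valuation.reset, hy] using hμ y
    · rw [hr]
      exact combine_reset ..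

/-- The runs of the automaton preserve representation by remainders below `1`, which are the
fractional parts. -/
theorem of_reachable (hlast : A.NeverResetsLast) (hone : A.ResetsAtMostOne)
    (h : Represented A hτ ℓ₀ υ₀ ℓ υ μ) (hμ : ∀ x, μ x < 1) {q : L × Valuation n}
    (hr : A.Reachable (ℓ, combine υ μ) q) :
    ∃ υ' μ', Represented A hτ ℓ₀ υ₀ q.1 υ' μ' ∧ (∀ x, μ' x < 1) ∧ combine υ' μ' = q.2 := by
  induction hr with
  | refl => exact ⟨υ, μ, h, hμ, rfl⟩
  | tail _ hstep ih =>
    obtain ⟨d, hstep⟩ := hstep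
    obtain ⟨υ₁, μ₁, h1, h2, h3⟩ := ih
    cases hstep with
    | delay ℓ₁ ν₁ d =>
      obtain rfl : combine υ₁ μ₁ = ν₁ := h3
      exact h1.delay hlast h2 d
    | discrete e he ν₁ hν₁ =>
      obtain rfl : combine υ₁ μ₁ = ν₁ := h3
      exact h1.discrete hlast hone he h2 hν₁

end Represented

end TimedReach

theorem mainTheorem3 {L : Type*} [Finite L] {n : ℕ} (A : TimedReach.TimedAutomaton L n)
    (hlast : A.NeverResetsLast) (hone : A.ResetsAtMostOne)
    (ℓ ℓ' : L) (ν ν' : TimedReach.Valuation n)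
    (τ : TimedReach.NType n) (hτ : TimedReach.typeOf ν.frac = τ.carrier) :
    A.Reachable (ℓ, ν) (ℓ', ν') ↔
      ∃ M' ∈ τ.matrix.closure,
        (TimedReach.regionMachine A τ).Reachable
          ((ℓ, τ.matrix), ν.floor) ((ℓ', M'), ν'.floor) ∧
        ν'.frac ∈ (TimedReach.PDBM.inst ν.frac hτ M').zone := by
  constructor
  · intro h
    rw [← ν.combine_floor_frac] at h
    obtain ⟨υ', μ', h1, h2, h3⟩ :=
      (TimedReach.Represented.refl (υ₀ := ν.floor) hτ).of_reachable hlast hone ν.frac_lt_one h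
    simp only at h3
    rw [← h3, TimedReach.Valuation.floor_combine υ' h2, TimedReach.Valuation.frac_combine υ' h2]
    exact h1
  · rintro ⟨M', -, hr, hz⟩
    have h := (TimedReach.reachable_of_regionMachine_reachable hτ hr).2 _ hz
    rwa [ν.combine_floor_frac, ν'.combine_floor_frac] at h
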